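/- Let $\mathcal C$ be a braided monoidal category with tensor product $\otimes$, unit object $K$ and braiding $c$, which admits equalizers and coequalizers (associativity and unit constraints are suppressed, and we write $H$ for $\mathrm{id}_H$). Let $(H,\eta,\mu)$ be a monoid and $(H,\varepsilon,\delta)$ a comonoid in $\mathcal C$, on the same object $H$, such that (a1) $\delta\circ\mu=(\mu\otimes\mu)\circ(H\otimes c_{H,H}\otimes H)\circ(\delta\otimes\delta)$; (a2) $\varepsilon\circ\mu\circ(\mu\otimes H)=\varepsilon\circ\mu\circ(H\otimes\mu)=((\varepsilon\circ\mu)\otimes(\varepsilon\circ\mu))\circ(H\otimes\delta\otimes H)=((\varepsilon\circ\mu)\otimes(\varepsilon\circ\mu))\circ(H\otimes(c_{H,H}^{-1}\circ\delta)\otimes H)$; (a3) $(\delta\otimes H)\circ\delta\circ\eta=(H\otimes\mu\otimes H)\circ((\delta\circ\eta)\otimes(\delta\circ\eta))=(H\otimes(\mu\circ c_{H,H}^{-1})\otimes H)\circ((\delta\circ\eta)\otimes(\delta\circ\eta))$. Put $\Pi^L=((\varepsilon\circ\mu)\otimes H)\circ(H\otimes c_{H,H})\circ((\delta\circ\eta)\otimes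 H)$ and $\Pi^R=(H\otimes(\varepsilon\circ\mu))\circ(c_{H,H}\otimes H)\circ(H\otimes(\delta\circ\eta))$, and write $a\ast b=\mu\circ(a\otimes b)\circ\delta$ for $a,b:H\to H$. Then $H$ is called a weak Hopf algebra if there is a morphism $\lambda:H\to H$ such that $\mathrm{id}_H\ast\lambda=\Pi^L$, $\lambda\ast\mathrm{id}_H=\Pi^R$, $\lambda\ast\Pi^L=\Pi^R\ast\lambda=\lambda$, and $$\mu\circ(\lambda\otimes\mu)\circ(\delta\otimes H)=\mu\circ(\Pi^R\otimes H),\qquad \mu\circ(H\otimes\mu)\circ(H\otimes\lambda\otimes H)\circ(\delta\otimes H)=\mu\circ(\Pi^L\otimes H),$$ $$\mu\circ(\mu\otimes\lambda)\circ(H\otimes\delta)=\mu\circ(H\otimes\Pi^L),\qquad \mu\circ(\mu\otimes H)\circ(H\otimes\lambda\otimes H)\circ(H\otimes\delta)=\mu\circ(H\otimes\Pi^R)$$ (the last four identities follow from the first two, as $\mu$ is associative). For $\sigma\in\{L,R\}$ let $$\Omega^1_\sigma=(\mu\otimes H)\circ(H\otimes\Pi^\sigma\otimes H)\circ(H\otimes\delta),\qquad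 \Omega^2_\sigma=(H\otimes\mu)\circ(H\otimes\Pi^\sigma\otimes H)\circ(\delta\otimes H).$$ Each of the four morphisms $\Omega^\alpha_\sigma:H\otimes H\to H\otimes H$ ($\alpha\in\{1,2\}$) is a split idempotent: there are an object $H\times^\alpha_\sigma H$ and morphisms $q^\alpha_\sigma:H\otimes H\to H\times^\alpha_\sigma H$, $j^\alpha_\sigma:H\times^\alpha_\sigma H\to H\otimes H$ with $j^\alpha_\sigma\circ q^\alpha_\sigma=\Omega^\alpha_\sigma$ and $q^\alpha_\sigma\circ j^\alpha_\sigma=\mathrm{id}$. Moreover, for every choice of such splittings, the following assertions are equivalent: (i) $H$ is a weak Hopf algebra; (ii) $f=q^1_R\circ\beta\circ j^1_L:H\times^1_LH\to H\times^1_RH$ is an isomorphism, where $\beta=(\mu\otimes H)\circ(H\otimes\delta)$; (iii) $g=q^2_L\circ\gamma\circ j^2_R:H\times^2_RH\to H\times^2_LH$ is an isomorphism, where $\gamma=(H\otimes\mu)\circ(\delta\otimes H)$. -/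

import Mathlib

open CategoryTheory MonoidalCategory MonObj ComonObj

universe v u

namespace WeakHopf

variable {C : Type u} [Category.{v} C] [MonoidalCategory C]

/-- A splitting of an endomorphism `e`: a factorization `e = j ∘ q` with `q ∘ j = id`.
It exists only if `e` is idempotent, and it is then unique up to a unique isomorphism. -/
structure Splitting {Y : C} (e : Y ⟶ Y) where
  /-- The image of the idempotent. -/
  obj : C
  /-- The projection onto the image. -/
  q : Y ⟶ obj
  /-- The inclusion of the image. -/
  j : obj ⟶ Y
  q_j : q ≫ j = e
  j_q : j ≫ q = 𝟙 obj

section Convolution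

variable (H : C) [MonObj H] [ComonObj H]

/-- The convolution product `a ∗ b = μ ∘ (a ⊗ b) ∘ δ` of endomorphisms of `H`. -/
def convolution {H : C} [MonObj H] [ComonObj H] (a b : H ⟶ H) : H ⟶ H :=
  Δ[H] ≫ (a ⊗ₘ b) ≫ μ[H]

/-- The right Galois morphism `(μ ⊗ H) ∘ (H ⊗ δ)`. -/
def galoisRight : H ⊗ H ⟶ H ⊗ H :=
  H ◁ Δ[H] ≫ (α_ H H H).inv ≫ μ[H] ▷ H

/-- The left Galois morphism `(H ⊗ μ) ∘ (δ ⊗ H)`. -/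
def galoisLeft : H ⊗ H ⟶ H ⊗ H :=
  Δ[H] ▷ H ≫ (α_ H H H).hom ≫ H ◁ μ[H]

/-- `(μ ⊗ H) ∘ (H ⊗ P ⊗ H) ∘ (H ⊗ δ)` for an endomorphism `P` of `H`. -/
def omegaOne {H : C} [MonObj H] [ComonObj H] (P : H ⟶ H) : H ⊗ H ⟶ H ⊗ H :=
  H ◁ Δ[H] ≫ H ◁ (P ▷ H) ≫ (α_ H H H).inv ≫ μ[H] ▷ H

/-- `(H ⊗ μ) ∘ (H ⊗ P ⊗ H) ∘ (δ ⊗ H)` for an endomorphism `P` of `H`. -/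
def omegaTwo {H : C} [MonObj H] [ComonObj H] (P : H ⟶ H) : H ⊗ H ⟶ H ⊗ H :=
  Δ[H] ▷ H ≫ (H ◁ P) ▷ H ≫ (α_ H H H).hom ≫ H ◁ μ[H]

end Convolution

variable [BraidedCategory C] (H : C) [MonObj H] [ComonObj H]

/-- The target morphism
`((ε ∘ μ) ⊗ H) ∘ (H ⊗ c) ∘ ((δ ∘ η) ⊗ H)`. -/
def piL : H ⟶ H :=
  (λ_ H).inv ≫ (η[H] ≫ Δ[H]) ▷ H ≫ (α_ H H H).hom ≫ H ◁ (β_ H H).hom ≫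
    (α_ H H H).inv ≫ (μ[H] ≫ ε[H]) ▷ H ≫ (λ_ H).hom

/-- The source morphism
`(H ⊗ (ε ∘ μ)) ∘ (c ⊗ H) ∘ (H ⊗ (δ ∘ η))`. -/
def piR : H ⟶ H :=
  (ρ_ H).inv ≫ H ◁ (η[H] ≫ Δ[H]) ≫ (α_ H H H).inv ≫ (β_ H H).hom ▷ H ≫
    (α_ H H H).hom ≫ H ◁ (μ[H] ≫ ε[H]) ≫ (ρ_ H).hom

/-- The compatibility conditions between the monoid and the comonoid structure of `H`:
weak multiplicativity of the coproduct (`mul_comul`), of the counit (`counit_mul_*`) and of the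
unit (`unit_comul_*`). -/
structure IsWeakBimonoid : Prop where
  /-- `δ ∘ μ = (μ ⊗ μ) ∘ δ_{H ⊗ H}`. -/
  mul_comul : μ[H] ≫ Δ[H] = (Δ[H] ⊗ₘ Δ[H]) ≫ tensorμ H H H H ≫ (μ[H] ⊗ₘ μ[H])
  /-- `ε ∘ μ ∘ (μ ⊗ H) = ε ∘ μ ∘ (H ⊗ μ)`. -/
  counit_mul_assoc : μ[H] ▷ H ≫ μ[H] ≫ ε[H] = (α_ H H H).hom ≫ H ◁ μ[H] ≫ μ[H] ≫ ε[H]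
  /-- `ε ∘ μ ∘ (μ ⊗ H) = ((ε ∘ μ) ⊗ (ε ∘ μ)) ∘ (H ⊗ δ ⊗ H)`. -/
  counit_mul_comul : μ[H] ▷ H ≫ μ[H] ≫ ε[H] =
    (H ◁ Δ[H]) ▷ H ≫ (α_ H H H).inv ▷ H ≫ (α_ (H ⊗ H) H H).hom ≫
      ((μ[H] ≫ ε[H]) ⊗ₘ (μ[H] ≫ ε[H])) ≫ (λ_ (𝟙_ C)).hom
  /-- `ε ∘ μ ∘ (μ ⊗ H) = ((ε ∘ μ) ⊗ (ε ∘ μ)) ∘ (H ⊗ (c⁻¹ ∘ δ) ⊗ H)`. -/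
  counit_mul_comul_braiding : μ[H] ▷ H ≫ μ[H] ≫ ε[H] =
    (H ◁ (Δ[H] ≫ (β_ H H).inv)) ▷ H ≫ (α_ H H H).inv ▷ H ≫ (α_ (H ⊗ H) H H).hom ≫
      ((μ[H] ≫ ε[H]) ⊗ₘ (μ[H] ≫ ε[H])) ≫ (λ_ (𝟙_ C)).hom
  /-- `(δ ⊗ H) ∘ δ ∘ η = (H ⊗ μ ⊗ H) ∘ ((δ ∘ η) ⊗ (δ ∘ η))`. -/
  unit_comul_mul : η[H] ≫ Δ[H] ≫ Δ[H] ▷ H =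
    (λ_ (𝟙_ C)).inv ≫ ((η[H] ≫ Δ[H]) ⊗ₘ (η[H] ≫ Δ[H])) ≫
      (α_ (H ⊗ H) H H).inv ≫ (α_ H H H).hom ▷ H ≫ (H ◁ μ[H]) ▷ H
  /-- `(δ ⊗ H) ∘ δ ∘ η = (H ⊗ (μ ∘ c⁻¹) ⊗ H) ∘ ((δ ∘ η) ⊗ (δ ∘ η))`. -/
  unit_comul_mul_braiding : η[H] ≫ Δ[H] ≫ Δ[H] ▷ H =
    (λ_ (𝟙_ C)).inv ≫ ((η[H] ≫ Δ[H]) ⊗ₘ (η[H] ≫ Δ[H])) ≫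
      (α_ (H ⊗ H) H H).inv ≫ (α_ H H H).hom ▷ H ≫ (H ◁ ((β_ H H).inv ≫ μ[H])) ▷ H

/-- The conditions on an antipode `S` of a weak Hopf quasigroup. -/
structure IsAntipode {H : C} [MonObj H] [ComonObj H] (S : H ⟶ H) : Prop where
  /-- `id ∗ S = Π^L`. -/
  id_conv : piL H = convolution (𝟙 H) S
  /-- `S ∗ id = Π^R`. -/
  conv_id : piR H = convolution S (𝟙 H)
  /-- `S ∗ Π^L = S`. -/
  conv_piL : convolution S (piL H) = S
  /-- `Π^R ∗ S = S`. -/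
  piR_conv : convolution (piR H) S = S
  /-- `μ ∘ (S ⊗ μ) ∘ (δ ⊗ H) = μ ∘ (Π^R ⊗ H)`. -/
  left_piR : Δ[H] ▷ H ≫ (α_ H H H).hom ≫ (S ⊗ₘ μ[H]) ≫ μ[H] = piR H ▷ H ≫ μ[H]
  /-- `μ ∘ (H ⊗ μ) ∘ (H ⊗ S ⊗ H) ∘ (δ ⊗ H) = μ ∘ (Π^L ⊗ H)`. -/
  left_piL : Δ[H] ▷ H ≫ (H ◁ S) ▷ H ≫ (α_ H H H).hom ≫ H ◁ μ[H] ≫ μ[H] = piL H ▷ H ≫ μ[H]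
  /-- `μ ∘ (μ ⊗ S) ∘ (H ⊗ δ) = μ ∘ (H ⊗ Π^L)`. -/
  right_piL : H ◁ Δ[H] ≫ (α_ H H H).inv ≫ (μ[H] ⊗ₘ S) ≫ μ[H] = H ◁ piL H ≫ μ[H]
  /-- `μ ∘ (μ ⊗ H) ∘ (H ⊗ S ⊗ H) ∘ (H ⊗ δ) = μ ∘ (H ⊗ Π^R)`. -/
  right_piR : H ◁ Δ[H] ≫ H ◁ (S ▷ H) ≫ (α_ H H H).inv ≫ μ[H] ▷ H ≫ μ[H] = H ◁ piR H ≫ μ[H]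

/-- `H` is a weak Hopf algebra in `C`, that is, a weak Hopf quasigroup whose product is
associative. (Associativity and the unit and comonoid laws are part of `MonObj` and `ComonObj`.) -/
structure IsWeakHopfAlgebra : Prop where
  isWeakBimonoid : IsWeakBimonoid H
  exists_antipode : ∃ S : H ⟶ H, IsAntipode S

/-- `Ω_L^1`. -/
abbrev omegaL1 : H ⊗ H ⟶ H ⊗ H := omegaOne (piL H)

/-- `Ω_R^1`. -/
abbrev omegaR1 : H ⊗ H ⟶ H ⊗ H := omegaOne (piR H)

/-- `Ω_L^2`. -/
abbrev omegaL2 : H ⊗ H ⟶ H ⊗ H := omegaTwo (piL H)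

/-- `Ω_R^2`. -/
abbrev omegaR2 : H ⊗ H ⟶ H ⊗ H := omegaTwo (piR H)

variable {H}

/-- `f = q_R^1 ∘ β ∘ j_L^1`, where `β` is the right Galois morphism. -/
def galoisF (sL : Splitting (omegaL1 H)) (sR : Splitting (omegaR1 H)) : sL.obj ⟶ sR.obj :=
  sL.j ≫ galoisRight H ≫ sR.q

/-- `g = q_L^2 ∘ γ ∘ j_R^2`, where `γ` is the left Galois morphism. -/
def galoisG (sR : Splitting (omegaR2 H)) (sL : Splitting (omegaL2 H)) : sR.obj ⟶ sL.obj :=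
  sR.j ≫ galoisLeft H ≫ sL.q

end WeakHopf

/-!
The morphisms `omegaTwo P` are exactly the endomorphisms of `H ⊗ H` that are linear for the right
multiplication on the second factor and colinear for the left comultiplication on the first, and
`P ↦ omegaTwo P` turns convolution into (reversed) composition, with `omegaTwo (𝟙 H)` the Galois
morphism `γ`. A split idempotent does not change the question of invertibility: `γ` induces an
isomorphism between the images of `Ω_R²` and `Ω_L²` if and only if it is invertible relative to
these two idempotents. The relative inverse is again linear and colinear, hence equal to
`omegaTwo S` for some `S`, and the equations between `γ`, `omegaTwo S`, `Ω_R²` and `Ω_L²` are the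
antipode equations for `S`.

The idempotents are understood through the monoid `H ⊗ H`, for which `δ` is multiplicative: the
weak comultiplicativity of the unit identifies `Ω_L²` with the left multiplication by the element
`δ ∘ η`, which is idempotent because `(δ ∘ η) · δ(x) = δ(1 · x) = δ(x)`.

Reversing the tensor product of `C`, that is, passing to the monoidal opposite `Cᴹᵒᵖ`, exchanges
`Π^L` with `Π^R`, `Ω¹` with `Ω²` and `β` with `γ`, and the morphism `f` for `C` is the morphism `g`
for `Cᴹᵒᵖ`.
-/

namespace WeakHopf

section RelativeInverse

variable {C : Type u} [Category.{v} C] {Y Z : C}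

theorem Splitting.e_q {e : Y ⟶ Y} (s : Splitting e) : e ≫ s.q = s.q :=
  calc e ≫ s.q = s.q ≫ s.j ≫ s.q := by rw [reassoc_of% s.q_j]
    _ = s.q := by rw [s.j_q, Category.comp_id]

theorem Splitting.j_e {e : Y ⟶ Y} (s : Splitting e) : s.j ≫ e = s.j :=
  calc s.j ≫ e = s.j ≫ s.q ≫ s.j := by rw [s.q_j]
    _ = s.j := by rw [reassoc_of% s.j_q]

theorem nonempty_splitting [IsIdempotentComplete C] {e : Y ⟶ Y} (he : e ≫ e = e) :
    Nonempty (Splitting e) := by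
  obtain ⟨X, j, q, hjq, hqj⟩ := IsIdempotentComplete.idempotents_split Y e he
  exact ⟨⟨X, q, j, hqj, hjq⟩⟩

/-- `b'` inverts `b` up to the endomorphisms `e` and `e'`, which in the applications are
idempotents: `b'` is then an inverse of `b` between the images of `e` and `e'`. -/
structure IsRelativeInverse (e : Y ⟶ Y) (e' : Z ⟶ Z) (b : Y ⟶ Z) (b' : Z ⟶ Y) : Prop where
  comp_left : b ≫ b' = e
  comp_right : b' ≫ b = e'
  left_id : e' ≫ b' = b'
  right_id : b' ≫ e = b'

namespace IsRelativeInverse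

theorem isIso_splitting {e : Y ⟶ Y} {e' : Z ⟶ Z} {b : Y ⟶ Z} {b' : Z ⟶ Y}
    (h : IsRelativeInverse e e' b b') (s : Splitting e) (s' : Splitting e') :
    IsIso (s.j ≫ b ≫ s'.q) := by
  refine ⟨s'.j ≫ b' ≫ s.q, ?_, ?_⟩
  · calc (s.j ≫ b ≫ s'.q) ≫ s'.j ≫ b' ≫ s.q
        = s.j ≫ b ≫ (e' ≫ b') ≫ s.q := by simp only [← s'.q_j, Category.assoc]
      _ = (s.j ≫ e) ≫ s.q := by
          simp only [h.left_id, ← h.comp_left, Category.assoc]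
      _ = 𝟙 _ := by rw [s.j_e, s.j_q]
  · calc (s'.j ≫ b' ≫ s.q) ≫ s.j ≫ b ≫ s'.q
        = s'.j ≫ (b' ≫ e) ≫ b ≫ s'.q := by simp only [← s.q_j, Category.assoc]
      _ = (s'.j ≫ e') ≫ s'.q := by
          simp only [h.right_id, ← h.comp_right, Category.assoc]
      _ = 𝟙 _ := by rw [s'.j_e, s'.j_q]

theorem of_isIso_splitting {e : Y ⟶ Y} {e' : Z ⟶ Z} {b : Y ⟶ Z} (s : Splitting e)
    (s' : Splitting e') (heb : e ≫ b = b) (hbe : b ≫ e' = b) [IsIso (s.j ≫ b ≫ s'.q)] :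
    IsRelativeInverse e e' b (s'.q ≫ inv (s.j ≫ b ≫ s'.q) ≫ s.j) where
  comp_left := by
    have h : b ≫ s'.q = s.q ≫ s.j ≫ b ≫ s'.q := by
      rw [reassoc_of% s.q_j, reassoc_of% heb]
    calc b ≫ s'.q ≫ inv (s.j ≫ b ≫ s'.q) ≫ s.j
        = (b ≫ s'.q) ≫ inv (s.j ≫ b ≫ s'.q) ≫ s.j := (Category.assoc ..).symm
      _ = (s.q ≫ s.j ≫ b ≫ s'.q) ≫ inv (s.j ≫ b ≫ s'.q) ≫ s.j := congrArg (· ≫ _) h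
      _ = e := by rw [Category.assoc, IsIso.hom_inv_id_assoc, s.q_j]
  comp_right := by
    have h : s.j ≫ b = (s.j ≫ b ≫ s'.q) ≫ s'.j := by
      simp only [Category.assoc, s'.q_j, hbe]
    rw [Category.assoc, Category.assoc, h, IsIso.inv_hom_id_assoc, s'.q_j]
  left_id := by rw [reassoc_of% s'.e_q]
  right_id := by simp only [Category.assoc, s.j_e]

theorem naturality {Y' Z' : C} {e : Y ⟶ Y} {e' : Z ⟶ Z} {b : Y ⟶ Z} {b' : Z ⟶ Y}
    {f : Y' ⟶ Y'} {f' : Z' ⟶ Z'} {g : Y' ⟶ Z'} {g' : Z' ⟶ Y'}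
    (hb : IsRelativeInverse e e' b b') (hg : IsRelativeInverse f f' g g') {t : Y ⟶ Y'} {t' : Z ⟶ Z'}
    (ht : b ≫ t' = t ≫ g) (he : e ≫ t = t ≫ f) (he' : e' ≫ t' = t' ≫ f') :
    b' ≫ t = t' ≫ g' :=
  calc b' ≫ t = b' ≫ e ≫ t := by rw [reassoc_of% hb.right_id]
    _ = b' ≫ (t ≫ g) ≫ g' := by rw [he, ← hg.comp_left, Category.assoc]
    _ = (b' ≫ b) ≫ t' ≫ g' := by simp only [← ht, Category.assoc]
    _ = (t' ≫ f') ≫ g' := by rw [hb.comp_right, reassoc_of% he', Category.assoc]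
    _ = t' ≫ g' := by rw [Category.assoc, hg.left_id]

theorem map {D : Type*} [Category* D] (F : C ⥤ D) {e : Y ⟶ Y} {e' : Z ⟶ Z} {b : Y ⟶ Z} {b' : Z ⟶ Y}
    (h : IsRelativeInverse e e' b b') :
    IsRelativeInverse (F.map e) (F.map e') (F.map b) (F.map b') where
  comp_left := by rw [← F.map_comp, h.comp_left]
  comp_right := by rw [← F.map_comp, h.comp_right]
  left_id := by rw [← F.map_comp, h.left_id]
  right_id := by rw [← F.map_comp, h.right_id]

end IsRelativeInverse

theorem isIso_splitting_iff {e : Y ⟶ Y} {e' : Z ⟶ Z} {b : Y ⟶ Z} (s : Splitting e)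
    (s' : Splitting e') (heb : e ≫ b = b) (hbe : b ≫ e' = b) :
    IsIso (s.j ≫ b ≫ s'.q) ↔ ∃ b' : Z ⟶ Y, IsRelativeInverse e e' b b' :=
  ⟨fun _ => ⟨_, .of_isIso_splitting s s' heb hbe⟩, fun ⟨_, h⟩ => h.isIso_splitting s s'⟩

end RelativeInverse

section Convolution

variable {C : Type u} [Category.{v} C] [MonoidalCategory C] {H : C} [MonObj H] [ComonObj H]

theorem omegaTwo_id : omegaTwo (𝟙 H) = galoisLeft H := by
  simp [omegaTwo, galoisLeft]

theorem omegaTwo_comp (P Q : H ⟶ H) :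
    omegaTwo Q ≫ omegaTwo P = omegaTwo (convolution P Q) := by
  simp only [omegaTwo, convolution, MonoidalCategory.tensorHom_def]
  calc _ = (Δ[H] ≫ H ◁ Q) ▷ H ⊗≫ (H ◁ μ[H] ≫ Δ[H] ▷ H) ⊗≫ H ◁ P ▷ H ⊗≫ H ◁ μ[H] := by monoidal
    _ = Δ[H] ▷ H ⊗≫ (H ◁ Q ≫ Δ[H] ▷ H) ▷ H ⊗≫ H ◁ (H ◁ μ[H] ≫ P ▷ H) ⊗≫ H ◁ μ[H] := by
      rw [whisker_exchange]; monoidal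
    _ = (Δ[H] ≫ Δ[H] ▷ H) ▷ H ⊗≫ H ◁ (H ◁ Q ≫ P ▷ H) ▷ H ⊗≫ H ◁ (H ◁ μ[H] ≫ μ[H]) := by
      rw [whisker_exchange, whisker_exchange]; monoidal
    _ = _ := by
      rw [comul_assoc_flip, mul_assoc_flip, whisker_exchange]; monoidal

/-- The endomorphism `P` of `H` determined by `omegaTwo P`. For an arbitrary `F` it is the
candidate for `P` in `F = omegaTwo P`. -/
def symbolTwo (F : H ⊗ H ⟶ H ⊗ H) : H ⟶ H :=
  (ρ_ H).inv ≫ H ◁ η[H] ≫ F ≫ ε[H] ▷ H ≫ (λ_ H).hom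

theorem symbolTwo_omegaTwo (P : H ⟶ H) : symbolTwo (omegaTwo P) = P := by
  simp only [symbolTwo, omegaTwo]
  calc _ = (ρ_ H).inv ≫ H ◁ η[H] ≫ (Δ[H] ≫ H ◁ P) ▷ H ⊗≫ (H ◁ μ[H] ≫ ε[H] ▷ H) ⊗≫ 𝟙 _ := by
        monoidal
    _ = (ρ_ H).inv ≫ H ◁ η[H] ≫ (Δ[H] ≫ (H ◁ P ≫ ε[H] ▷ H)) ▷ H ⊗≫ μ[H] ⊗≫ 𝟙 _ := by
      rw [whisker_exchange ε[H]]; monoidal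
    _ = (ρ_ H).inv ≫ H ◁ η[H] ≫ ((Δ[H] ≫ ε[H] ▷ H) ≫ (𝟙_ C ◁ P)) ▷ H ⊗≫ μ[H] ⊗≫ 𝟙 _ := by
      rw [whisker_exchange ε[H] P, Category.assoc]
    _ = (ρ_ H).inv ≫ (H ◁ η[H] ≫ P ▷ H) ⊗≫ μ[H] ⊗≫ 𝟙 _ := by
      rw [counit_comul]; monoidal
    _ = P ⊗≫ (H ◁ η[H] ≫ μ[H]) ⊗≫ 𝟙 _ := by
      rw [whisker_exchange]; monoidal
    _ = P := by rw [MonObj.mul_one]; monoidal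

theorem omegaTwo_injective : Function.Injective (omegaTwo (H := H)) :=
  Function.LeftInverse.injective symbolTwo_omegaTwo

theorem omegaTwo_mul (P : H ⟶ H) :
    omegaTwo P ▷ H ≫ (α_ H H H).hom ≫ H ◁ μ[H] = ((α_ H H H).hom ≫ H ◁ μ[H]) ≫ omegaTwo P := by
  simp only [omegaTwo]
  symm
  calc _ = 𝟙 _ ⊗≫ (H ◁ μ[H] ≫ (Δ[H] ≫ H ◁ P) ▷ H) ⊗≫ H ◁ μ[H] := by monoidal
    _ = 𝟙 _ ⊗≫ (Δ[H] ≫ H ◁ P) ▷ H ▷ H ⊗≫ H ◁ (H ◁ μ[H] ≫ μ[H]) := by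
      rw [whisker_exchange]; monoidal
    _ = _ := by rw [mul_assoc_flip]; monoidal

theorem omegaTwo_comul (P : H ⟶ H) :
    omegaTwo P ≫ Δ[H] ▷ H ≫ (α_ H H H).hom =
      (Δ[H] ▷ H ≫ (α_ H H H).hom) ≫ H ◁ omegaTwo P := by
  simp only [omegaTwo]
  calc _ = (Δ[H] ≫ H ◁ P) ▷ H ⊗≫ (H ◁ μ[H] ≫ Δ[H] ▷ H) ⊗≫ 𝟙 _ := by monoidal
    _ = (Δ[H] ≫ (H ◁ P ≫ Δ[H] ▷ H)) ▷ H ⊗≫ H ◁ H ◁ μ[H] := by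
      rw [whisker_exchange]; monoidal
    _ = (Δ[H] ≫ Δ[H] ▷ H) ▷ H ⊗≫ H ◁ H ◁ P ▷ H ⊗≫ H ◁ H ◁ μ[H] := by
      rw [whisker_exchange]; monoidal
    _ = _ := by rw [comul_assoc_flip]; monoidal

theorem omegaTwo_symbolTwo {F : H ⊗ H ⟶ H ⊗ H}
    (h_lin : F ▷ H ≫ (α_ H H H).hom ≫ H ◁ μ[H] = ((α_ H H H).hom ≫ H ◁ μ[H]) ≫ F)
    (h_colin : F ≫ Δ[H] ▷ H ≫ (α_ H H H).hom = (Δ[H] ▷ H ≫ (α_ H H H).hom) ≫ H ◁ F) :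
    omegaTwo (symbolTwo F) = F := by
  simp only [omegaTwo, symbolTwo]
  calc _ = 𝟙 _ ⊗≫ ((Δ[H] ▷ 𝟙_ C ≫ (H ⊗ H) ◁ η[H]) ⊗≫ H ◁ F ⊗≫ H ◁ ε[H] ▷ H) ▷ H ⊗≫
          H ◁ μ[H] := by monoidal
    _ = 𝟙 _ ⊗≫ (H ◁ η[H] ≫ ((Δ[H] ▷ H ≫ (α_ H H H).hom) ≫ H ◁ F) ⊗≫ H ◁ ε[H] ▷ H) ▷ H ⊗≫
          H ◁ μ[H] := by rw [← whisker_exchange]; monoidal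
    _ = 𝟙 _ ⊗≫ (H ◁ η[H] ≫ F ≫ (Δ[H] ≫ H ◁ ε[H]) ▷ H) ▷ H ⊗≫ H ◁ μ[H] := by
      rw [← h_colin]; monoidal
    _ = 𝟙 _ ⊗≫ H ◁ η[H] ▷ H ⊗≫ F ▷ H ≫ (α_ H H H).hom ≫ H ◁ μ[H] := by
      rw [comul_counit]; monoidal
    _ = 𝟙 _ ⊗≫ H ◁ (η[H] ▷ H ≫ μ[H]) ≫ F := by rw [h_lin]; monoidal
    _ = F := by rw [MonObj.one_mul]; monoidal

/-- `S` inverts the identity of `H` for the convolution product, up to the endomorphisms `L` on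
the left and `R` on the right. For `L = Π^L` and `R = Π^R` these are the antipode equations. -/
structure IsRelativeConvInverse (L R S : H ⟶ H) : Prop where
  id_conv : convolution (𝟙 H) S = L
  conv_id : convolution S (𝟙 H) = R
  right_conv : convolution R S = S
  conv_left : convolution S L = S

theorem isRelativeInverse_omegaTwo_iff {L R S : H ⟶ H} :
    IsRelativeInverse (omegaTwo R) (omegaTwo L) (galoisLeft H) (omegaTwo S) ↔
      IsRelativeConvInverse L R S := by
  rw [← omegaTwo_id]
  constructor
  · rintro ⟨h_right, h_left, h_conv_left, h_right_conv⟩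
    rw [omegaTwo_comp] at h_right h_left h_conv_left h_right_conv
    exact ⟨omegaTwo_injective h_left, omegaTwo_injective h_right,
      omegaTwo_injective h_right_conv, omegaTwo_injective h_conv_left⟩
  · intro h
    constructor <;> rw [omegaTwo_comp]
    exacts [congrArg _ h.conv_id, congrArg _ h.id_conv, congrArg _ h.conv_left,
      congrArg _ h.right_conv]

theorem IsRelativeInverse.omegaTwo_symbolTwo {L R : H ⟶ H} {b : H ⊗ H ⟶ H ⊗ H}
    (h : IsRelativeInverse (omegaTwo R) (omegaTwo L) (galoisLeft H) b) :
    omegaTwo (symbolTwo b) = b := by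
  rw [← omegaTwo_id] at h
  exact WeakHopf.omegaTwo_symbolTwo
    ((h.map (tensorRight H)).naturality h (omegaTwo_mul _) (omegaTwo_mul _) (omegaTwo_mul _))
    (h.naturality (h.map (tensorLeft H)) (omegaTwo_comul _) (omegaTwo_comul _) (omegaTwo_comul _))

theorem isIso_galoisLeft_splitting_iff {L R : H ⟶ H} (hL : convolution L (𝟙 H) = 𝟙 H)
    (hR : convolution (𝟙 H) R = 𝟙 H) (sR : Splitting (omegaTwo R)) (sL : Splitting (omegaTwo L)) :
    IsIso (sR.j ≫ galoisLeft H ≫ sL.q) ↔ ∃ S : H ⟶ H, IsRelativeConvInverse L R S := by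
  have hR_galois : omegaTwo R ≫ galoisLeft H = galoisLeft H := by
    rw [← omegaTwo_id, omegaTwo_comp, hR]
  have hL_galois : galoisLeft H ≫ omegaTwo L = galoisLeft H := by
    rw [← omegaTwo_id, omegaTwo_comp, hL]
  rw [isIso_splitting_iff sR sL hR_galois hL_galois]
  constructor
  · rintro ⟨b, hb⟩
    exact ⟨symbolTwo b, isRelativeInverse_omegaTwo_iff.mp (hb.omegaTwo_symbolTwo.symm ▸ hb)⟩
  · rintro ⟨S, hS⟩
    exact ⟨omegaTwo S, isRelativeInverse_omegaTwo_iff.mpr hS⟩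

theorem convolution_whiskerRight_mul (a b : H ⟶ H) :
    convolution a b ▷ H ≫ μ[H] =
      Δ[H] ▷ H ≫ (α_ H H H).hom ≫ (a ⊗ₘ (b ▷ H ≫ μ[H])) ≫ μ[H] := by
  simp only [convolution, MonoidalCategory.tensorHom_def']
  calc _ = (Δ[H] ≫ H ◁ b ≫ a ▷ H) ▷ H ≫ μ[H] ▷ H ≫ μ[H] := by monoidal
    _ = (Δ[H] ≫ H ◁ b) ▷ H ⊗≫ (a ▷ (H ⊗ H) ≫ H ◁ μ[H]) ≫ μ[H] := by
      rw [MonObj.mul_assoc]; monoidal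
    _ = _ := by rw [← whisker_exchange]; monoidal

theorem whiskerLeft_convolution_mul (a b : H ⟶ H) :
    H ◁ convolution a b ≫ μ[H] =
      H ◁ Δ[H] ≫ (α_ H H H).inv ≫ ((H ◁ a ≫ μ[H]) ⊗ₘ b) ≫ μ[H] := by
  simp only [convolution, MonoidalCategory.tensorHom_def]
  calc _ = H ◁ (Δ[H] ≫ a ▷ H ≫ H ◁ b) ≫ H ◁ μ[H] ≫ μ[H] := by monoidal
    _ = H ◁ (Δ[H] ≫ a ▷ H) ⊗≫ ((H ⊗ H) ◁ b ≫ μ[H] ▷ H) ≫ μ[H] := by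
      rw [mul_assoc_flip]; monoidal
    _ = _ := by rw [whisker_exchange]; monoidal

end Convolution

section Antipode

variable {C : Type u} [Category.{v} C] [MonoidalCategory C] [BraidedCategory C]
  {H : C} [MonObj H] [ComonObj H]

theorem isAntipode_iff {S : H ⟶ H} : IsAntipode S ↔ IsRelativeConvInverse (piL H) (piR H) S := by
  refine ⟨fun h => ⟨h.id_conv.symm, h.conv_id.symm, h.piR_conv, h.conv_piL⟩, fun h => ?_⟩
  refine ⟨h.id_conv.symm, h.conv_id.symm, h.conv_left, h.right_conv, ?_, ?_, ?_, ?_⟩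
  · simp [← h.conv_id, convolution_whiskerRight_mul]
  · simp [← h.id_conv, convolution_whiskerRight_mul]
  · simp [← h.id_conv, whiskerLeft_convolution_mul]
  · simp [← h.conv_id, whiskerLeft_convolution_mul]

end Antipode

section LeftMul

variable {C : Type u} [Category.{v} C] [MonoidalCategory C]

/-- `f` is compatible with the products of the monoids `A` and `B`. In contrast to `IsMonHom`, the
unit need not be preserved: this is the case of the coproduct of a weak bialgebra. -/
def IsMultiplicative {A B : C} [MonObj A] [MonObj B] (f : A ⟶ B) : Prop :=
  μ[A] ≫ f = (f ⊗ₘ f) ≫ μ[B]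

/-- `g` is an endomorphism of `A` as a right module over itself. -/
def IsRightLinear {A : C} [MonObj A] (g : A ⟶ A) : Prop :=
  μ[A] ≫ g = g ▷ A ≫ μ[A]

/-- Left multiplication by the (generalized) element `w` of the monoid `A`. -/
def leftMul {A : C} [MonObj A] (w : 𝟙_ C ⟶ A) : A ⟶ A :=
  (λ_ A).inv ≫ w ▷ A ≫ μ[A]

section Monoidal

variable {A B D : C} [MonObj A] [MonObj B] [MonObj D]

theorem isMultiplicative_id : IsMultiplicative (𝟙 A) := by
  simp [IsMultiplicative]

theorem IsMultiplicative.comp {f : A ⟶ B} {g : B ⟶ D} (hf : IsMultiplicative f)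
    (hg : IsMultiplicative g) : IsMultiplicative (f ≫ g) := by
  unfold IsMultiplicative at *
  rw [reassoc_of% hf, hg, tensorHom_comp_tensorHom_assoc]

theorem isRightLinear_id : IsRightLinear (𝟙 A) := by
  simp [IsRightLinear]

theorem IsRightLinear.comp {g h : A ⟶ A} (hg : IsRightLinear g) (hh : IsRightLinear h) :
    IsRightLinear (g ≫ h) := by
  unfold IsRightLinear at *
  rw [reassoc_of% hg, hh, MonoidalCategory.comp_whiskerRight_assoc]

theorem IsRightLinear.conj {g : A ⟶ A} (hg : IsRightLinear g) (i : A ≅ B)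
    (hi : IsMultiplicative i.hom) : IsRightLinear (i.inv ≫ g ≫ i.hom) := by
  have hi_inv : μ[B] ≫ i.inv = (i.inv ⊗ₘ i.inv) ≫ μ[A] := by
    rw [Iso.comp_inv_eq, Category.assoc, hi, tensorHom_comp_tensorHom_assoc]
    simp
  unfold IsRightLinear IsMultiplicative at *
  rw [reassoc_of% hi_inv, reassoc_of% hg, hi, ← tensorHom_id, ← tensorHom_id]
  simp only [tensorHom_comp_tensorHom_assoc, Category.id_comp, Iso.inv_hom_id]

theorem isRightLinear_leftMul (w : 𝟙_ C ⟶ A) : IsRightLinear (leftMul w) := by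
  simp only [IsRightLinear, leftMul]
  calc _ = 𝟙 _ ⊗≫ (𝟙_ C ◁ μ[A] ≫ w ▷ A) ≫ μ[A] := by monoidal
    _ = _ := by rw [whisker_exchange, Category.assoc, mul_assoc_flip]; monoidal

theorem one_leftMul (w : 𝟙_ C ⟶ A) : η[A] ≫ leftMul w = w := by
  simp only [leftMul]
  calc _ = (λ_ _).inv ≫ (𝟙_ C ◁ η[A] ≫ w ▷ A) ≫ μ[A] := by simp
    _ = _ := by rw [whisker_exchange, Category.assoc, MonObj.mul_one]; monoidal

theorem leftMul_one : leftMul η[A] = 𝟙 A := by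
  simp [leftMul]

theorem IsRightLinear.leftMul_one_comp {g : A ⟶ A} (hg : IsRightLinear g) :
    leftMul (η[A] ≫ g) = g := by
  rw [leftMul, MonoidalCategory.comp_whiskerRight_assoc, ← hg]
  simp

theorem IsRightLinear.ext {g h : A ⟶ A} (hg : IsRightLinear g) (hh : IsRightLinear h)
    (h_one : η[A] ≫ g = η[A] ≫ h) : g = h := by
  rw [← hg.leftMul_one_comp, h_one, hh.leftMul_one_comp]

theorem IsMultiplicative.leftMul_comp {f : A ⟶ B} (hf : IsMultiplicative f) (w : 𝟙_ C ⟶ A) :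
    leftMul w ≫ f = f ≫ leftMul (w ≫ f) :=
  calc leftMul w ≫ f = (λ_ A).inv ≫ w ▷ A ≫ μ[A] ≫ f := by simp only [leftMul, Category.assoc]
    _ = (λ_ A).inv ≫ ((w ≫ f) ▷ A ≫ B ◁ f) ≫ μ[B] := by
      rw [hf, MonoidalCategory.tensorHom_def]
      simp only [MonoidalCategory.comp_whiskerRight, Category.assoc]
    _ = f ≫ leftMul (w ≫ f) := by rw [← whisker_exchange]; simp [leftMul]

end Monoidal

section Braided

variable [BraidedCategory C] {A B D F : C} [MonObj A] [MonObj D]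

theorem IsMultiplicative.tensorHom [MonObj B] [MonObj F] {f : A ⟶ B} {g : D ⟶ F}
    (hf : IsMultiplicative f) (hg : IsMultiplicative g) : IsMultiplicative (f ⊗ₘ g) :=
  calc μ[A ⊗ D] ≫ (f ⊗ₘ g) = tensorμ A D A D ≫ ((f ⊗ₘ f) ≫ μ[B] ⊗ₘ (g ⊗ₘ g) ≫ μ[F]) := by
        rw [MonObj.tensorObj.mul_def, Category.assoc, tensorHom_comp_tensorHom, hf, hg]
    _ = ((f ⊗ₘ g) ⊗ₘ (f ⊗ₘ g)) ≫ tensorμ B F B F ≫ (μ[B] ⊗ₘ μ[F]) := by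
        rw [← tensorHom_comp_tensorHom, tensorμ_natural_assoc]

theorem IsRightLinear.tensorHom {f : A ⟶ A} {g : D ⟶ D} (hf : IsRightLinear f)
    (hg : IsRightLinear g) : IsRightLinear (f ⊗ₘ g) :=
  calc μ[A ⊗ D] ≫ (f ⊗ₘ g) = tensorμ A D A D ≫ (f ▷ A ≫ μ[A] ⊗ₘ g ▷ D ≫ μ[D]) := by
        rw [MonObj.tensorObj.mul_def, Category.assoc, tensorHom_comp_tensorHom, hf, hg]
    _ = (f ⊗ₘ g) ▷ (A ⊗ D) ≫ tensorμ A D A D ≫ (μ[A] ⊗ₘ μ[D]) := by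
        rw [← tensorHom_comp_tensorHom, tensorμ_natural_left_assoc]

end Braided

end LeftMul

section WeakUnit

variable {C : Type u} [Category.{v} C] [MonoidalCategory C] [BraidedCategory C]

/-- Naturality of the braiding at `w`, with one of the two crossings moved to the other side. -/
theorem element_comp_braiding {X Y Z : C} (w : 𝟙_ C ⟶ X ⊗ Y) :
    (λ_ Z).inv ≫ w ▷ Z ≫ (α_ X Y Z).hom ≫ X ◁ (β_ Y Z).hom =
      (ρ_ Z).inv ≫ Z ◁ w ≫ (α_ Z X Y).inv ≫ (β_ X Z).inv ▷ Y ≫ (α_ X Z Y).hom := by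
  have h := BraidedCategory.braiding_naturality_left w Z
  rw [BraidedCategory.braiding_tensor_left_hom, braiding_tensorUnit_left] at h
  rw [← cancel_mono (α_ X Z Y).inv, ← cancel_mono ((β_ X Z).hom ▷ Y),
    ← cancel_mono (α_ Z X Y).hom]
  simp only [Category.assoc] at h ⊢
  rw [h]
  simp

variable (H : C) [MonObj H] [ComonObj H]

/-- The second half of the weak comultiplicativity of the unit, the condition
`(δ ⊗ H) ∘ δ ∘ η = (H ⊗ (μ ∘ c⁻¹) ⊗ H) ∘ ((δ ∘ η) ⊗ (δ ∘ η))`. -/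
def WeaklyComultiplicativeUnit : Prop :=
  η[H] ≫ Δ[H] ≫ Δ[H] ▷ H =
    (λ_ (𝟙_ C)).inv ≫ ((η[H] ≫ Δ[H]) ⊗ₘ (η[H] ≫ Δ[H])) ≫
      (α_ (H ⊗ H) H H).inv ≫ (α_ H H H).hom ▷ H ≫ (H ◁ ((β_ H H).inv ≫ μ[H])) ▷ H

/-- Left multiplication by the element `δ ∘ η` of the monoid `H ⊗ H`. -/
def leftMulUnitComul : H ⊗ H ⟶ H ⊗ H :=
  leftMul (η[H] ≫ Δ[H])

theorem leftMulUnitComul_counit :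
    leftMulUnitComul H ≫ ε[H] ▷ H ≫ (λ_ H).hom = piL H ▷ H ≫ μ[H] := by
  calc _ = 𝟙 _ ⊗≫ (η[H] ≫ Δ[H]) ▷ H ▷ H ⊗≫ H ◁ (β_ H H).hom ▷ H ⊗≫
          ((μ[H] ⊗ₘ μ[H]) ≫ ε[H] ▷ H) ⊗≫ 𝟙 _ := by
        simp only [leftMulUnitComul, leftMul, MonObj.tensorObj.mul_def, tensorμ]; monoidal
    _ = 𝟙 _ ⊗≫ (η[H] ≫ Δ[H]) ▷ H ▷ H ⊗≫ H ◁ (β_ H H).hom ▷ H ⊗≫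
          ((μ[H] ≫ ε[H]) ▷ (H ⊗ H) ≫ 𝟙_ C ◁ μ[H]) ⊗≫ 𝟙 _ := by
        rw [tensorHom_comp_whiskerRight, MonoidalCategory.tensorHom_def]
    _ = _ := by simp only [piL]; monoidal

theorem rightUnitor_inv_leftMulUnitComul :
    (ρ_ H).inv ≫ H ◁ η[H] ≫ leftMulUnitComul H =
      (λ_ H).inv ≫ (η[H] ≫ Δ[H]) ▷ H ≫ (α_ H H H).hom ≫ H ◁ (β_ H H).hom ≫
        (α_ H H H).inv ≫ μ[H] ▷ H := by
  calc _ = 𝟙 _ ⊗≫ (𝟙_ C ◁ H ◁ η[H] ≫ (η[H] ≫ Δ[H]) ▷ (H ⊗ H)) ⊗≫ H ◁ (β_ H H).hom ▷ H ⊗≫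
          (μ[H] ⊗ₘ μ[H]) := by
        simp only [leftMulUnitComul, leftMul, MonObj.tensorObj.mul_def, tensorμ]; monoidal
    _ = 𝟙 _ ⊗≫ (η[H] ≫ Δ[H]) ▷ H ⊗≫
          H ◁ (H ◁ (H ◁ η[H]) ≫ (α_ H H H).inv ≫ (β_ H H).hom ▷ H) ⊗≫ (μ[H] ⊗ₘ μ[H]) := by
        rw [whisker_exchange]; monoidal
    _ = 𝟙 _ ⊗≫ (η[H] ≫ Δ[H]) ▷ H ⊗≫ H ◁ (β_ H H).hom ⊗≫
          ((H ⊗ H) ◁ (H ◁ η[H]) ≫ (μ[H] ⊗ₘ μ[H])) := by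
        rw [associator_inv_naturality_right_assoc, whisker_exchange]; monoidal
    _ = 𝟙 _ ⊗≫ (η[H] ≫ Δ[H]) ▷ H ⊗≫ H ◁ (β_ H H).hom ⊗≫ (μ[H] ⊗ₘ (ρ_ H).hom) := by
        rw [whiskerLeft_comp_tensorHom, MonObj.mul_one]
    _ = _ := by simp only [MonoidalCategory.tensorHom_def]; monoidal

variable {H}

theorem unit_comul_whiskerLeft_leftMulUnitComul (hunit : WeaklyComultiplicativeUnit H) :
    (η[H] ≫ Δ[H]) ≫ H ◁ ((ρ_ H).inv ≫ H ◁ η[H] ≫ leftMulUnitComul H) =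
      (η[H] ≫ Δ[H]) ≫ Δ[H] ▷ H ≫ (α_ H H H).hom :=
  calc (η[H] ≫ Δ[H]) ≫ H ◁ ((ρ_ H).inv ≫ H ◁ η[H] ≫ leftMulUnitComul H)
      = (η[H] ≫ Δ[H]) ≫ H ◁ (((λ_ H).inv ≫ (η[H] ≫ Δ[H]) ▷ H ≫ (α_ H H H).hom ≫
          H ◁ (β_ H H).hom) ≫ (α_ H H H).inv ≫ μ[H] ▷ H) := by
        rw [rightUnitor_inv_leftMulUnitComul]; simp only [Category.assoc]
    _ = ((λ_ (𝟙_ C)).inv ≫ ((η[H] ≫ Δ[H]) ⊗ₘ (η[H] ≫ Δ[H])) ≫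
          (α_ (H ⊗ H) H H).inv ≫ (α_ H H H).hom ▷ H ≫ (H ◁ ((β_ H H).inv ≫ μ[H])) ▷ H) ≫
          (α_ H H H).hom := by
        rw [element_comp_braiding]; simp only [MonoidalCategory.tensorHom_def]; monoidal
    _ = (η[H] ≫ Δ[H]) ≫ Δ[H] ▷ H ≫ (α_ H H H).hom := by
        rw [← hunit]; simp only [Category.assoc]

theorem comul_leftMulUnitComul (hmul : IsMultiplicative Δ[H]) :
    Δ[H] ≫ leftMulUnitComul H = Δ[H] := by
  rw [leftMulUnitComul, ← hmul.leftMul_comp, leftMul_one, Category.id_comp]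

theorem leftMulUnitComul_idem (hmul : IsMultiplicative Δ[H]) :
    leftMulUnitComul H ≫ leftMulUnitComul H = leftMulUnitComul H := by
  have hlin : IsRightLinear (leftMulUnitComul H) := isRightLinear_leftMul _
  refine (hlin.comp hlin).ext hlin ?_
  calc η[H ⊗ H] ≫ leftMulUnitComul H ≫ leftMulUnitComul H
      = η[H] ≫ Δ[H] ≫ leftMulUnitComul H := by
        rw [leftMulUnitComul, reassoc_of% one_leftMul, Category.assoc]
    _ = η[H] ≫ Δ[H] := by rw [comul_leftMulUnitComul hmul]
    _ = η[H ⊗ H] ≫ leftMulUnitComul H := (one_leftMul _).symm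

theorem leftMul_unit_comul_comul (hunit : WeaklyComultiplicativeUnit H) :
    leftMul ((η[H] ≫ Δ[H]) ≫ Δ[H] ▷ H ≫ (α_ H H H).hom) =
      ((α_ H H H).inv ≫ leftMulUnitComul H ▷ H ≫ (α_ H H H).hom) ≫ H ◁ leftMulUnitComul H := by
  have hlin : IsRightLinear (leftMulUnitComul H) := isRightLinear_leftMul _
  have hleft : IsRightLinear (leftMulUnitComul H ▷ H) := by
    simpa only [tensorHom_id] using hlin.tensorHom (isRightLinear_id (A := H))
  have hright : IsRightLinear (H ◁ leftMulUnitComul H) := by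
    simpa only [id_tensorHom] using (isRightLinear_id (A := H)).tensorHom hlin
  have hassoc : η[H ⊗ (H ⊗ H)] ≫ (α_ H H H).inv = η[(H ⊗ H) ⊗ H] := by
    rw [Iso.comp_inv_eq]
    exact (IsMonHom.one_hom (α_ H H H).hom).symm
  refine (isRightLinear_leftMul _).ext ((hleft.conj _ mul_associator).comp hright) ?_
  rw [one_leftMul, ← unit_comul_whiskerLeft_leftMulUnitComul hunit]
  symm
  calc η[H ⊗ (H ⊗ H)] ≫ ((α_ H H H).inv ≫ leftMulUnitComul H ▷ H ≫ (α_ H H H).hom) ≫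
        H ◁ leftMulUnitComul H
      = (λ_ (𝟙_ C)).inv ≫ ((η[H ⊗ H] ≫ leftMulUnitComul H) ⊗ₘ η[H]) ≫ (α_ H H H).hom ≫
          H ◁ leftMulUnitComul H := by
        simp only [Category.assoc]
        rw [reassoc_of% hassoc, MonObj.tensorObj.one_def, Category.assoc,
          tensorHom_comp_whiskerRight_assoc]
    _ = (λ_ (𝟙_ C)).inv ≫ ((η[H] ≫ Δ[H]) ⊗ₘ η[H]) ≫ (α_ H H H).hom ≫
          H ◁ leftMulUnitComul H := by rw [leftMulUnitComul, one_leftMul]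
    _ = _ := by rw [MonoidalCategory.tensorHom_def]; monoidal

theorem leftMulUnitComul_comul (hmul : IsMultiplicative Δ[H])
    (hunit : WeaklyComultiplicativeUnit H) :
    leftMulUnitComul H ≫ Δ[H] ▷ H ≫ (α_ H H H).hom =
      (Δ[H] ▷ H ≫ (α_ H H H).hom) ≫ H ◁ leftMulUnitComul H := by
  have hcomul : IsMultiplicative (Δ[H] ▷ H ≫ (α_ H H H).hom) := by
    rw [← tensorHom_id]
    exact (hmul.tensorHom isMultiplicative_id).comp mul_associator
  calc leftMulUnitComul H ≫ Δ[H] ▷ H ≫ (α_ H H H).hom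
      = (Δ[H] ▷ H ≫ (α_ H H H).hom) ≫
          leftMul ((η[H] ≫ Δ[H]) ≫ Δ[H] ▷ H ≫ (α_ H H H).hom) := hcomul.leftMul_comp _
    _ = (Δ[H] ≫ leftMulUnitComul H) ▷ H ≫ (α_ H H H).hom ≫ H ◁ leftMulUnitComul H := by
      rw [leftMul_unit_comul_comul hunit]; simp
    _ = _ := by rw [comul_leftMulUnitComul hmul, Category.assoc]

theorem omegaTwo_piL (hmul : IsMultiplicative Δ[H]) (hunit : WeaklyComultiplicativeUnit H) :
    omegaTwo (piL H) = leftMulUnitComul H :=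
  calc omegaTwo (piL H) = (Δ[H] ▷ H ≫ (α_ H H H).hom) ≫ H ◁ (piL H ▷ H ≫ μ[H]) := by
        simp only [omegaTwo]; monoidal
    _ = leftMulUnitComul H ≫ (Δ[H] ≫ H ◁ ε[H]) ▷ H ⊗≫ 𝟙 _ := by
        rw [← leftMulUnitComul_counit, MonoidalCategory.whiskerLeft_comp, ← Category.assoc,
          ← leftMulUnitComul_comul hmul hunit]
        monoidal
    _ = leftMulUnitComul H := by rw [comul_counit]; monoidal

theorem piL_convolution_id (hmul : IsMultiplicative Δ[H]) :
    convolution (piL H) (𝟙 H) = 𝟙 H := by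
  rw [convolution, tensorHom_id, ← leftMulUnitComul_counit,
    reassoc_of% comul_leftMulUnitComul hmul, reassoc_of% counit_comul]
  simp

theorem piL_convolution_piL (hmul : IsMultiplicative Δ[H])
    (hunit : WeaklyComultiplicativeUnit H) : convolution (piL H) (piL H) = piL H :=
  omegaTwo_injective <| by
    rw [← omegaTwo_comp, omegaTwo_piL hmul hunit, leftMulUnitComul_idem hmul]

end WeakUnit

section MonoidalOpposite

open MonoidalOpposite

variable {C : Type u} [Category.{v} C] {Y : C}

theorem isIso_mop_iff {Z : C} {f : Y ⟶ Z} : IsIso f.mop ↔ IsIso f :=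
  ⟨fun _ => inferInstanceAs (IsIso (unmopFunctor C |>.map f.mop)),
    fun _ => inferInstanceAs (IsIso (mopFunctor C |>.map f))⟩

/-- The splitting of an idempotent of `C`, seen in the monoidal opposite of `C`. -/
def Splitting.mop {e : Y ⟶ Y} (s : Splitting e) : Splitting e.mop where
  obj := MonoidalOpposite.mop s.obj
  q := s.q.mop
  j := s.j.mop
  q_j := congrArg Quiver.Hom.mop s.q_j
  j_q := congrArg Quiver.Hom.mop s.j_q

variable [MonoidalCategory C]

/-- The comonoid `H` for the reversed tensor product, with the same counit and coproduct. -/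
instance mopComonObj (H : C) [ComonObj H] : ComonObj (mop H) where
  counit := ε[H].mop
  comul := Δ[H].mop
  counit_comul := Quiver.Hom.unmop_inj (comul_counit H)
  comul_counit := Quiver.Hom.unmop_inj (counit_comul H)
  comul_assoc := Quiver.Hom.unmop_inj (by simp)

variable {H : C} [MonObj H] [ComonObj H]

theorem convolution_mop (a b : H ⟶ H) : convolution a.mop b.mop = (convolution b a).mop := rfl

theorem omegaTwo_mop (a : H ⟶ H) : omegaTwo a.mop = (omegaOne a).mop := rfl

theorem galoisLeft_mop : galoisLeft (mop H) = (galoisRight H).mop := rfl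

theorem omegaOne_comp (P Q : H ⟶ H) :
    omegaOne P ≫ omegaOne Q = omegaOne (convolution P Q) :=
  Quiver.Hom.mop_inj <| by
    rw [mop_comp, ← omegaTwo_mop, ← omegaTwo_mop, omegaTwo_comp, convolution_mop, omegaTwo_mop]

theorem isRelativeConvInverse_mop_iff {L R S : H ⟶ H} :
    IsRelativeConvInverse R.mop L.mop S.mop ↔ IsRelativeConvInverse L R S := by
  have hmop {a b : H ⟶ H} : a.mop = b.mop ↔ a = b := Quiver.Hom.mop_inj.eq_iff
  have hid : 𝟙 (mop H) = (𝟙 H).mop := rfl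
  constructor
  · rintro ⟨h_id_conv, h_conv_id, h_right_conv, h_conv_left⟩
    rw [hid] at h_id_conv h_conv_id
    rw [convolution_mop, hmop] at h_id_conv h_conv_id h_right_conv h_conv_left
    exact ⟨h_conv_id, h_id_conv, h_conv_left, h_right_conv⟩
  · intro h
    exact ⟨hmop.mpr h.conv_id, hmop.mpr h.id_conv, hmop.mpr h.conv_left, hmop.mpr h.right_conv⟩

theorem isIso_galoisRight_splitting_iff {L R : H ⟶ H} (hL : convolution L (𝟙 H) = 𝟙 H)
    (hR : convolution (𝟙 H) R = 𝟙 H) (sL : Splitting (omegaOne L)) (sR : Splitting (omegaOne R)) :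
    IsIso (sL.j ≫ galoisRight H ≫ sR.q) ↔ ∃ S : H ⟶ H, IsRelativeConvInverse L R S :=
  calc IsIso (sL.j ≫ galoisRight H ≫ sR.q)
      ↔ IsIso (sL.mop.j ≫ galoisLeft (mop H) ≫ sR.mop.q) := by
        rw [← isIso_mop_iff, mop_comp, mop_comp, galoisLeft_mop]; rfl
    _ ↔ ∃ S : mop H ⟶ mop H, IsRelativeConvInverse R.mop L.mop S :=
        isIso_galoisLeft_splitting_iff (H := mop H) (congrArg Quiver.Hom.mop hR)
          (congrArg Quiver.Hom.mop hL) sL.mop sR.mop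
    _ ↔ ∃ S : H ⟶ H, IsRelativeConvInverse L R S :=
        ⟨fun ⟨S, hS⟩ => ⟨S.unmop, isRelativeConvInverse_mop_iff.mp hS⟩,
          fun ⟨S, hS⟩ => ⟨S.mop, isRelativeConvInverse_mop_iff.mpr hS⟩⟩

variable [BraidedCategory C]

theorem piL_mop : piL (mop H) = (piR H).mop := rfl

theorem tensorμ_mop (W X Y Z : C) :
    tensorμ (mop W) (mop X) (mop Y) (mop Z) = (tensorμ Z Y X W).mop :=
  Quiver.Hom.unmop_inj (by simp [tensorμ])

theorem IsMultiplicative.comul_mop (hmul : IsMultiplicative Δ[H]) :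
    IsMultiplicative Δ[mop H] := by
  change μ[mop H] ≫ Δ[mop H] = (Δ[mop H] ⊗ₘ Δ[mop H]) ≫ tensorμ (mop H) (mop H) (mop H) (mop H) ≫
    (μ[mop H] ⊗ₘ μ[mop H])
  rw [tensorμ_mop]
  exact congrArg Quiver.Hom.mop hmul

theorem WeaklyComultiplicativeUnit.mop (hunit : WeaklyComultiplicativeUnit H) :
    WeaklyComultiplicativeUnit (mop H) := by
  refine Quiver.Hom.unmop_inj ?_
  change η[H] ≫ Δ[H] ≫ H ◁ Δ[H] =
    (ρ_ (𝟙_ C)).inv ≫ ((η[H] ≫ Δ[H]) ⊗ₘ (η[H] ≫ Δ[H])) ≫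
      (α_ H H (H ⊗ H)).hom ≫ H ◁ (α_ H H H).inv ≫ H ◁ (((β_ H H).inv ≫ μ[H]) ▷ H)
  rw [comul_assoc, reassoc_of% show η[H] ≫ Δ[H] ≫ Δ[H] ▷ H = _ from hunit]
  monoidal

theorem id_convolution_piR (hmul : IsMultiplicative Δ[H]) :
    convolution (𝟙 H) (piR H) = 𝟙 H :=
  Quiver.Hom.mop_inj <| by
    rw [← convolution_mop, ← piL_mop]
    exact piL_convolution_id hmul.comul_mop

theorem piR_convolution_piR (hmul : IsMultiplicative Δ[H])
    (hunit : WeaklyComultiplicativeUnit H) : convolution (piR H) (piR H) = piR H :=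
  Quiver.Hom.mop_inj <| by
    rw [← convolution_mop, ← piL_mop, piL_convolution_piL hmul.comul_mop hunit.mop]

end MonoidalOpposite

end WeakHopf

theorem mainTheorem3_general {C : Type u} [Category.{v} C] [MonoidalCategory C]
    [BraidedCategory C] [IsIdempotentComplete C] (H : C) [MonObj H] [ComonObj H]
    (hmul : WeakHopf.IsMultiplicative Δ[H]) (hunit : WeakHopf.WeaklyComultiplicativeUnit H) :
    (Nonempty (WeakHopf.Splitting (WeakHopf.omegaL1 H)) ∧
      Nonempty (WeakHopf.Splitting (WeakHopf.omegaR1 H)) ∧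
      Nonempty (WeakHopf.Splitting (WeakHopf.omegaL2 H)) ∧
      Nonempty (WeakHopf.Splitting (WeakHopf.omegaR2 H))) ∧
    (∀ (sL1 : WeakHopf.Splitting (WeakHopf.omegaL1 H))
      (sR1 : WeakHopf.Splitting (WeakHopf.omegaR1 H))
      (sL2 : WeakHopf.Splitting (WeakHopf.omegaL2 H))
      (sR2 : WeakHopf.Splitting (WeakHopf.omegaR2 H)),
      List.TFAE [∃ S : H ⟶ H, WeakHopf.IsAntipode S,
        IsIso (WeakHopf.galoisF sL1 sR1),
        IsIso (WeakHopf.galoisG sR2 sL2)]) := by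
  have hL := WeakHopf.piL_convolution_id hmul
  have hR := WeakHopf.id_convolution_piR hmul
  have hLL := WeakHopf.piL_convolution_piL hmul hunit
  have hRR := WeakHopf.piR_convolution_piR hmul hunit
  refine ⟨⟨?_, ?_, ?_, ?_⟩, fun sL1 sR1 sL2 sR2 => ?_⟩
  · exact WeakHopf.nonempty_splitting (by rw [WeakHopf.omegaOne_comp, hLL])
  · exact WeakHopf.nonempty_splitting (by rw [WeakHopf.omegaOne_comp, hRR])
  · exact WeakHopf.nonempty_splitting (by rw [WeakHopf.omegaTwo_comp, hLL])
  · exact WeakHopf.nonempty_splitting (by rw [WeakHopf.omegaTwo_comp, hRR])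
  simp only [WeakHopf.isAntipode_iff]
  tfae_have 1 ↔ 2 := (WeakHopf.isIso_galoisRight_splitting_iff hL hR sL1 sR1).symm
  tfae_have 1 ↔ 3 := (WeakHopf.isIso_galoisLeft_splitting_iff hL hR sR2 sL2).symm
  tfae_finish

theorem mainTheorem3 {C : Type u} [Category.{v} C] [MonoidalCategory C] [BraidedCategory C]
    [Limits.HasEqualizers C] [Limits.HasCoequalizers C]
    (H : C) [MonObj H] [ComonObj H] (hH : WeakHopf.IsWeakBimonoid H) :
    (Nonempty (WeakHopf.Splitting (WeakHopf.omegaL1 H)) ∧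
      Nonempty (WeakHopf.Splitting (WeakHopf.omegaR1 H)) ∧
      Nonempty (WeakHopf.Splitting (WeakHopf.omegaL2 H)) ∧
      Nonempty (WeakHopf.Splitting (WeakHopf.omegaR2 H))) ∧
    (∀ (sL1 : WeakHopf.Splitting (WeakHopf.omegaL1 H))
      (sR1 : WeakHopf.Splitting (WeakHopf.omegaR1 H))
      (sL2 : WeakHopf.Splitting (WeakHopf.omegaL2 H))
      (sR2 : WeakHopf.Splitting (WeakHopf.omegaR2 H)),
      List.TFAE [WeakHopf.IsWeakHopfAlgebra H,
        IsIso (WeakHopf.galoisF sL1 sR1),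
        IsIso (WeakHopf.galoisG sR2 sL2)]) := by
  have := (Idempotents.isIdempotentComplete_iff_hasEqualizer_of_id_and_idempotent C).mpr
    fun _ _ _ => inferInstance
  have hS : WeakHopf.IsWeakHopfAlgebra H ↔ ∃ S : H ⟶ H, WeakHopf.IsAntipode S :=
    ⟨(·.exists_antipode), fun h => ⟨hH, h⟩⟩
  simpa only [hS] using mainTheorem3_general H hH.mul_comul hH.unit_comul_mul_braiding
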